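/- Let $1\to D\xrightarrow{\iota}\widehat G\xrightarrow{\lambda}G\to 1$ be a short exact sequence of groups and $n\ge 0$ an integer. For a group $K$ let $C^\bullet(K;U(1))$ be the complex of normalised inhomogeneous cochains with values in the trivial module $U(1)$ (written additively), $\delta$ its coboundary operator, and $Z^\bullet$, $H^\bullet$ its cocycles and cohomology. Let $F^pC^m(\widehat G;U(1))\subseteq C^m(\widehat G;U(1))$ be the group of normalised $m$-cochains which vanish as soon as $m-p+1$ entries lie in $\iota(D)$ (so it is $0$ for $p>m$ and everything for $p\le 0$), and let $(E_r^{p,q},\mathrm d_r^{p,q})$ be the Lyndon–Hochschild–Serre spectral sequence induced by this filtration: \[ E_r^{p,q}=Z_r^{p,q}\big/\big(B_r^{p,q}+Z_{r-1}^{p+1,q-1}\big), \] \[ Z_r^{p,q}=\{c\in F^pC^{p+q}(\widehat G;U(1)) : \delta c\in F^{p+r}C^{p+q+1}(\widehat G;U(1))\},\qquad B_r^{p,q}=\delta\big(F^{p-r+1}C^{p+q-1}(\widehat G;U(1))\big)\cap F^pC^{p+q}(\widehat G;U(1)), \] with $\mathrm d_r^{p,q}\colon E_r^{p,q}\to E_r^{p+r,q-r+1}$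 induced by $\delta$. By restriction of cochains along $\iota$, $E_2^{0,n}$ is identified with the group $H^n(D;U(1))^G$ of classes invariant under conjugation in $\widehat G$, and $E_{r+1}^{0,n}$ with $\ker \mathrm d_r^{0,n}\subseteq E_r^{0,n}$ for $r\ge 2$. Let $\omega\in Z^n(D;U(1))$ have $[\omega]\in H^n(D;U(1))^G$. Its obstructions are $\mathrm d_2^{0,n}\omega,\dots,\mathrm d_{n+1}^{0,n}\omega$, where $\mathrm d_r^{0,n}\omega\in E_r^{r,n+1-r}$ is $\mathrm d_r^{0,n}$ applied to the element of $E_r^{0,n}$ given by $[\omega]$, which is defined once the preceding obstructions vanish. (a) If all the obstructions $\mathrm d_r^{0,n}\omega$, $2\le r\le n+1$, vanish, then there exists $\widehat\omega\in Z^n(\widehat G;U(1))$ with $\iota^*\widehat\omega=\omega$. (b) If the first $n-1$ obstructions $\mathrm d_r^{0,n}\omega$, $2\le r\le n$, vanish, then there exist $\omega'\in C^n(\widehat G;U(1))$ and $\theta\in Z^{n+1}(G;U(1))$ with $\iota^*\omega'=\omega$ and $\delta\omega'=\lambda^*\theta$. -/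

import Mathlib

/-! # Group cohomology with coefficients in `U(1)` and the Lyndon-Hochschild-Serre spectral sequence

Cochains are inhomogeneous and normalised, with values in the trivial module `U(1)`, which is
written additively. The spectral sequence of an extension is the one induced by the filtration of
the normalised cochains of the middle group by the number of entries in the normal subgroup. -/

noncomputable section

namespace LHS

universe u v

/-- The circle group `U(1)`, written additively. -/
abbrev U1 : Type := Additive Circle

section Cochains

/-- All functions `G ^ n → U(1)`. -/
abbrev Cochain (G : Type u) (n : ℕ) : Type u := (Fin n → G) → U1

/-- The coboundary operator for the trivial action: `(δ f)(g₀, …, gₙ)` is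
`f(g₁, …, gₙ) + ∑_{j < n} (-1)^(j+1) f(g₀, …, gⱼ gⱼ₊₁, …, gₙ) + (-1)^(n+1) f(g₀, …, gₙ₋₁)`.
The last term is the summand `j = n` below. -/
def δ (G : Type u) [Group G] (n : ℕ) : Cochain G n →+ Cochain G (n + 1) where
  toFun f g := f (fun i => g i.succ) +
    ∑ j : Fin (n + 1), (-1 : ℤ) ^ ((j : ℕ) + 1) • f (Fin.contractNth j (· * ·) g)
  map_zero' := by
    funext g
    simp
  map_add' f f' := by
    funext g
    simp only [Pi.add_apply, smul_add, Finset.sum_add_distrib]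
    abel

theorem δ_δ (G : Type u) [Group G] (n : ℕ) (f : Cochain G n) : δ G (n + 1) (δ G n f) = 0 := by
  let A : Rep.{u} (ULift.{u} ℤ) G := Rep.trivial (ULift.{u} ℤ) G (ULift.{u} U1)
  have key : ∀ (m : ℕ) (f : Cochain G m) (g : Fin (m + 1) → G),
      ((inhomogeneousCochains.d A m).hom
        (fun g => (ULift.up (f g) : ULift.{u} U1)) g : ULift.{u} U1) = ULift.up (δ G m f g) := by
    intro m f g
    have hs : ∀ (k : ℕ) (a : U1), ((-1 : ULift.{u} ℤ) ^ k • (ULift.up a : ULift.{u} U1)) =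
        ULift.up ((-1 : ℤ) ^ k • a) := by
      intro k a
      rfl
    have hsum : ∀ h : Fin (m + 1) → U1, (∑ j, (ULift.up (h j) : ULift.{u} U1)) =
        ULift.up (∑ j, h j) := fun h =>
      (map_sum (AddEquiv.ulift.symm : U1 ≃+ ULift.{u} U1) h Finset.univ).symm
    rw [inhomogeneousCochains.d_hom_apply]
    change (ULift.up (f fun i => g i.succ) : ULift.{u} U1) +
      ∑ j : Fin (m + 1), (-1 : ULift.{u} ℤ) ^ ((j : ℕ) + 1) •
        (ULift.up (f (Fin.contractNth j (· * ·) g)) : ULift.{u} U1) = _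
    simp only [hs]
    rw [hsum]
    rfl
  have h := groupCohomology.inhomogeneousCochains.d_comp_d n A
  have h2 := congrArg (fun F => F.hom (fun g => (ULift.up (f g) : ULift.{u} U1))) h
  funext g
  have h3 := congrFun h2 g
  simp only [ModuleCat.hom_comp, LinearMap.comp_apply] at h3
  have h4 := funext (key n f)
  rw [h4] at h3
  erw [key (n + 1) (δ G n f) g] at h3
  exact congrArg ULift.down h3

/-- Pullback `φ^*` of cochains along a group homomorphism `φ`. -/
def pullback {H : Type v} {G : Type u} [Group H] [Group G] (φ : H →* G) (n : ℕ) :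
    Cochain G n →+ Cochain H n where
  toFun f x := f (fun i => φ (x i))
  map_zero' := rfl
  map_add' _ _ := rfl

theorem δ_pullback {H : Type v} {G : Type u} [Group H] [Group G] (φ : H →* G) (n : ℕ)
    (f : Cochain G n) : δ H n (pullback φ n f) = pullback φ (n + 1) (δ G n f) := by
  funext x
  have h : ∀ j : Fin (n + 1), (fun i => φ (Fin.contractNth j (· * ·) x i)) =
      Fin.contractNth j (· * ·) (fun i => φ (x i)) := by
    intro j
    funext i
    simp only [Fin.contractNth]
    split_ifs <;> simp
  simp [δ, pullback, h]

/-- The normalised cochains `C^n(G; U(1))`: they vanish as soon as one entry is `1`. -/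
def C (G : Type u) [Group G] (n : ℕ) : AddSubgroup (Cochain G n) where
  carrier := {f | ∀ x, (∃ i, x i = 1) → f x = 0}
  zero_mem' _ _ := rfl
  add_mem' {f f'} hf hf' x hx := by simp [hf x hx, hf' x hx]
  neg_mem' {f} hf x hx := by simp [hf x hx]

/-- The normalised cocycles `Z^n(G; U(1))`. -/
def Z (G : Type u) [Group G] (n : ℕ) : AddSubgroup (Cochain G n) := C G n ⊓ (δ G n).ker

/-- The coboundaries `B^n(G; U(1))` of normalised cochains. -/
def B (G : Type u) [Group G] : (n : ℕ) → AddSubgroup (Cochain G n)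
  | 0 => ⊥
  | n + 1 => (C G n).map (δ G n)

/-- The group cohomology `H^n(G; U(1))`, computed from the normalised cochain complex. -/
abbrev H (G : Type u) [Group G] (n : ℕ) : Type u := Z G n ⧸ (B G n).addSubgroupOf (Z G n)

/-- The class of a cocycle. -/
def H.mk {G : Type u} [Group G] {n : ℕ} (ω : Z G n) : H G n := QuotientAddGroup.mk ω

theorem pullback_mem_C {H : Type v} {G : Type u} [Group H] [Group G] (φ : H →* G) {n : ℕ}
    {f : Cochain G n} (hf : f ∈ C G n) : pullback φ n f ∈ C H n := by
  rintro x ⟨i, hi⟩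
  exact hf _ ⟨i, by simp [hi]⟩

theorem pullback_mem_Z {H : Type v} {G : Type u} [Group H] [Group G] (φ : H →* G) {n : ℕ}
    {f : Cochain G n} (hf : f ∈ Z G n) : pullback φ n f ∈ Z H n := by
  refine ⟨pullback_mem_C φ hf.1, ?_⟩
  have h : δ G n f = 0 := hf.2
  change δ H n (pullback φ n f) = 0
  rw [δ_pullback, h, map_zero]

theorem pullback_mem_B {H : Type v} {G : Type u} [Group H] [Group G] (φ : H →* G) {n : ℕ}
    {f : Cochain G n} (hf : f ∈ B G n) : pullback φ n f ∈ B H n := by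
  cases n with
  | zero =>
    have h : f = 0 := hf
    rw [h, map_zero]
    exact zero_mem _
  | succ n =>
    obtain ⟨y, hy, rfl⟩ := hf
    exact ⟨pullback φ n y, pullback_mem_C φ hy, δ_pullback φ n y⟩

/-- The map `φ^*` induced on cohomology by a group homomorphism `φ`. -/
def H.map {K : Type v} {G : Type u} [Group K] [Group G] (φ : K →* G) (n : ℕ) : H G n →+ H K n :=
  QuotientAddGroup.map _ _
    (((pullback φ n).comp (Z G n).subtype).codRestrict (Z K n) fun f => pullback_mem_Z φ f.2)
    fun _ hf => pullback_mem_B φ hf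

end Cochains

section SpectralSequence

variable {D E G : Type*} [Group D] [Group E] [Group G] (S : GroupExtension D E G)

/-- The filtration step `F^p C^n(E; U(1))`: the normalised `n`-cochains that vanish as soon as
`n - p + 1` entries are in the image of `D`. This is everything for `p ≤ 0`, and `0` for `p > n`
(there the set `s` can be empty). -/
def F (p : ℤ) (n : ℕ) : AddSubgroup (Cochain E n) where
  carrier := {f | f ∈ C E n ∧ ∀ s : Finset (Fin n), (n : ℤ) - p + 1 ≤ s.card →
    ∀ x : Fin n → E, (∀ i ∈ s, x i ∈ S.inl.range) → f x = 0}
  zero_mem' := ⟨zero_mem _, fun _ _ _ _ => rfl⟩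
  add_mem' {f f'} hf hf' :=
    ⟨add_mem hf.1 hf'.1, fun s hs x hx => by simp [hf.2 s hs x hx, hf'.2 s hs x hx]⟩
  neg_mem' {f} hf := ⟨neg_mem hf.1, fun s hs x hx => by simp [hf.2 s hs x hx]⟩

theorem F_mono {p p' : ℤ} (h : p ≤ p') (n : ℕ) : F S p' n ≤ F S p n := fun _ hf =>
  ⟨hf.1, fun s hs x hx => hf.2 s (by omega) x hx⟩

/-- `Zr r p n` is `Z_r^{p,q}` for `q = n - p`: the kernel of
`δ : F^p C^n → C^(n+1) / F^(p+r) C^(n+1)`. -/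
def Zr (r p : ℤ) (n : ℕ) : AddSubgroup (Cochain E n) :=
  F S p n ⊓ (F S (p + r) (n + 1)).comap (δ E n)

/-- `Br r p n` is `B_r^{p,q}` for `q = n - p`, namely `δ (F^(p-r+1) C^(n-1)) ∩ F^p C^n`. -/
def Br (r p : ℤ) : (n : ℕ) → AddSubgroup (Cochain E n)
  | 0 => ⊥
  | n + 1 => (F S (p - r + 1) n).map (δ E n) ⊓ F S p (n + 1)

/-- The term `E_r^{p,q}` of the spectral sequence for `q = n - p` (so `n` is the total degree),
namely `Z_r^{p,q} / (B_r^{p,q} + Z_{r-1}^{p+1,q-1})`. -/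
abbrev Er (r p : ℤ) (n : ℕ) : Type _ :=
  Zr S r p n ⧸ (Br S r p n ⊔ Zr S (r - 1) (p + 1) n).addSubgroupOf (Zr S r p n)

/-- `δ` as a map from `Z_r^{p,q}` to `Z_r^{p+r,q-r+1}`. -/
def δZr (r p : ℤ) (n : ℕ) : Zr S r p n →+ Zr S r (p + r) (n + 1) :=
  ((δ E n).comp (Zr S r p n).subtype).codRestrict (Zr S r (p + r) (n + 1)) fun f =>
    ⟨f.2.2, by
      change δ E (n + 1) (δ E n f) ∈ F S (p + r + r) (n + 1 + 1)
      rw [δ_δ]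
      exact zero_mem _⟩

/-- The differential `d_r^{p,q} : E_r^{p,q} → E_r^{p+r,q-r+1}` for `q = n - p`, induced by `δ`. -/
def dr (r p : ℤ) (n : ℕ) : Er S r p n →+ Er S r (p + r) (n + 1) :=
  QuotientAddGroup.map _ _ (δZr S r p n) <| by
    intro f hf
    obtain ⟨b, hb, z, hz, hbz⟩ := AddSubgroup.mem_sup.1 (AddSubgroup.mem_addSubgroupOf.1 hf)
    have hb0 : δ E n b = 0 := by
      cases n with
      | zero =>
        have h : b = 0 := hb
        rw [h, map_zero]
      | succ n =>
        obtain ⟨y, -, rfl⟩ := hb.1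
        exact δ_δ E n y
    have hfz : δ E n f = δ E n z := by
      rw [← hbz, map_add, hb0, zero_add]
    refine AddSubgroup.mem_addSubgroupOf.2 (AddSubgroup.mem_sup_left ?_)
    change δ E n f ∈ _
    rw [hfz]
    refine ⟨⟨z, F_mono S (by omega) n hz.1, rfl⟩, ?_⟩
    have h := hz.2
    rw [show p + 1 + (r - 1) = p + r by ring] at h
    exact h

theorem pullback_inl_eq_zero {p : ℤ} (hp : 1 ≤ p) {n : ℕ} {f : Cochain E n} (hf : f ∈ F S p n) :
    pullback S.inl n f = 0 := by
  funext x
  exact hf.2 Finset.univ (by simp; omega) _ fun i _ => ⟨x i, rfl⟩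

/-- Restriction of `Z_r^{0,n}` to `D`. -/
def resZr (r : ℤ) (hr : 1 ≤ r) (n : ℕ) : Zr S r 0 n →+ Z D n :=
  ((pullback S.inl n).comp (Zr S r 0 n).subtype).codRestrict (Z D n) fun f =>
    ⟨pullback_mem_C _ f.2.1.1, by
      change δ D n (pullback S.inl n f) = 0
      rw [δ_pullback]
      exact pullback_inl_eq_zero S (by omega) f.2.2⟩

/-- The map `E_r^{0,n} → H^n(D; U(1))` induced by restriction of cochains to `D`. It is injective,
and for `r = 2` its image is `H^n(D; U(1))^G`; by means of it the groups `E_r^{0,n}`, `r ≥ 2`, are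
regarded as a decreasing sequence of subgroups of `H^n(D; U(1))^G`. -/
def edge (r : ℤ) (hr : 1 ≤ r) (n : ℕ) : Er S r 0 n →+ H D n :=
  QuotientAddGroup.map _ _ (resZr S r hr n) <| by
    intro f hf
    obtain ⟨b, hb, z, hz, hbz⟩ := AddSubgroup.mem_sup.1 (AddSubgroup.mem_addSubgroupOf.1 hf)
    have hfb : pullback S.inl n f = pullback S.inl n b := by
      rw [← hbz, map_add, pullback_inl_eq_zero S (by omega) hz.1, add_zero]
    refine AddSubgroup.mem_addSubgroupOf.2 ?_
    change pullback S.inl n f ∈ B D n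
    rw [hfb]
    refine pullback_mem_B S.inl ?_
    cases n with
    | zero => exact hb
    | succ n =>
      obtain ⟨y, hy, h⟩ := hb.1
      exact ⟨y, hy.1, h⟩

/-- A class in `H^n(D; U(1))` is in `H^n(D; U(1))^G`. An element of `G` acts on `H^n(D; U(1))`
through the conjugation of `D` by any of its preimages in the middle group. -/
def IsInvariant {n : ℕ} (c : H D n) : Prop :=
  ∀ x : E, H.map (S.conjAct x).toMonoidHom n c = c

/-- The obstruction `d_r^{0,n} ω = 0`: the element of `E_r^{0,n}` given by the class `c` of `ω` is
sent to `0` by `d_r^{0,n}`. For `r = 2` and an invariant `c` this element exists and is unique, and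
if the obstructions for `2, …, r - 1` vanish as well, it exists and is unique for `r`. -/
def ObstructionVanishes {n : ℕ} (c : H D n) (r : ℤ) : Prop :=
  ∀ (hr : 1 ≤ r) (e : Er S r 0 n), edge S r hr n e = c → dr S r 0 n e = 0

end SpectralSequence

end LHS

namespace LHS

universe u

/-! Vanishing of `d_r` is used on cochains. If δc ∈ F^r and its class dies in E_r, then δc = δy + z
with y ∈ F^1 and z ∈ F^(r+1); so c - y restricts to D as c does, and its coboundary lies one step
deeper (`exists_mem_Zr_succ`).

The induction starts from a lift of ω with coboundary in F^2 (`exists_mem_Zr_two`). A section σ of λ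
gives the left D-equivariant retraction ρ(y) = y σ(λ y)⁻¹ of the middle group onto D, and ω, read as
a homogeneous cochain, is pulled back along ρ. As ρ is only D-equivariant, the coboundary involves
conjugates of ω by σ(g)⁻¹; invariance of the class supplies primitives η of their differences from
ω, which correct it.

If all obstructions vanish, δc ∈ F^(n+2) C^(n+1) = 0, which is (a). With one fewer, δc ∈ F^(n+1)
C^(n+1) is a cocycle vanishing as soon as one entry is in D. Such a cocycle is inflated from G
(`exists_pullback_rightHom_eq`), which is (b). -/

/-! ### Faces of tuples and normalised cochains. -/

theorem δ_apply {G : Type u} [Group G] {n : ℕ} (f : Cochain G n) (x : Fin (n + 1) → G) :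
    δ G n f x = f (Fin.tail x) +
      ∑ j : Fin (n + 1), (-1 : ℤ) ^ ((j : ℕ) + 1) • f (Fin.contractNth j (· * ·) x) := rfl

/-- Multiplying the entries `j` and `j + 1` of a tuple keeps all other entries. -/
theorem exists_contractNth_eq {G : Type u} [Group G] {n : ℕ} (y : Fin (n + 1) → G)
    {p j : Fin (n + 1)} (h : j ≠ p) (h' : (j : ℕ) + 1 ≠ p) :
    ∃ k, Fin.contractNth j (· * ·) y k = y p := by
  rcases lt_or_gt_of_ne fun e => h (Fin.ext e) with hlt | hlt
  · refine ⟨⟨p - 1, by omega⟩, ?_⟩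
    rw [Fin.contractNth_apply_of_gt _ _ _ _ (by simp only []; omega)]
    exact congrArg y (Fin.ext (by simp; omega))
  · refine ⟨⟨p, by omega⟩, ?_⟩
    rw [Fin.contractNth_apply_of_lt _ _ _ _ (by simpa using hlt)]
    exact congrArg y (Fin.ext (by simp))

theorem contractNth_eq_removeNth {G : Type u} [Group G] {n : ℕ} {y : Fin (n + 1) → G}
    {p : Fin (n + 1)} (h : y p = 1) : Fin.contractNth p (· * ·) y = p.removeNth y := by
  funext k
  rw [Fin.removeNth_apply]
  rcases lt_trichotomy (k : ℕ) p with hk | hk | hk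
  · rw [Fin.contractNth_apply_of_lt _ _ _ _ hk, Fin.succAbove_of_castSucc_lt _ _ hk]
  · have hp : k.castSucc = p := Fin.ext hk
    rw [Fin.contractNth_apply_of_eq _ _ _ _ hk, Fin.succAbove_of_le_castSucc _ _ hp.ge, hp, h,
      one_mul]
  · rw [Fin.contractNth_apply_of_gt _ _ _ _ hk, Fin.succAbove_of_le_castSucc _ _ hk.le]

theorem contractNth_castSucc_eq_removeNth_succ {G : Type u} [Group G] {n : ℕ}
    {y : Fin (n + 1) → G} {p : Fin n} (h : y p.succ = 1) :
    Fin.contractNth p.castSucc (· * ·) y = p.succ.removeNth y := by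
  funext k
  rw [Fin.removeNth_apply]
  rcases lt_trichotomy (k : ℕ) p with hk | hk | hk
  · rw [Fin.contractNth_apply_of_lt _ _ _ _ hk,
      Fin.succAbove_of_castSucc_lt _ _ (Nat.lt_succ_of_lt hk)]
  · obtain rfl : k = p := Fin.ext hk
    rw [Fin.contractNth_apply_of_eq _ _ _ _ hk,
      Fin.succAbove_of_castSucc_lt _ _ Fin.castSucc_lt_succ, h, mul_one]
  · rw [Fin.contractNth_apply_of_gt _ _ _ _ hk, Fin.succAbove_of_le_castSucc _ _ hk]

/-- The coboundary of a normalised cochain is normalised. -/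
theorem δ_mem_C {G : Type u} [Group G] {n : ℕ} {f : Cochain G n} (hf : f ∈ C G n) :
    δ G n f ∈ C G (n + 1) := by
  rintro x ⟨p, hp⟩
  have key : ∀ j : Fin (n + 1), j ≠ p → (j : ℕ) + 1 ≠ p →
      f (Fin.contractNth j (· * ·) x) = 0 := by
    intro j h h'
    obtain ⟨k, hk⟩ := exists_contractNth_eq x h h'
    exact hf _ ⟨k, hk.trans hp⟩
  -- Only two faces can lose the entry 1. Both delete it, with opposite signs.
  rw [δ_apply]
  cases p using Fin.cases with
  | zero =>
    rw [Finset.sum_eq_single (0 : Fin (n + 1)), contractNth_eq_removeNth hp]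
    · have : Fin.removeNth 0 x = Fin.tail x := by
        funext k
        simp [Fin.removeNth_apply, Fin.tail]
      simp [this]
    · intro j _ hj
      rw [key j hj (by simp), smul_zero]
    · simp
  | succ p =>
    rw [Finset.sum_eq_add p.castSucc p.succ (Fin.castSucc_lt_succ).ne,
      contractNth_eq_removeNth hp, contractNth_castSucc_eq_removeNth_succ hp,
      hf (Fin.tail x) ⟨p, hp⟩]
    · simp [pow_succ]
    · rintro j - ⟨hj, hj'⟩
      rw [key j hj' (by simpa [Fin.ext_iff] using hj), smul_zero]
    · simp
    · simp

/-! ### Cocycles inflated from the quotient. -/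

section Pullback

variable {D E G : Type*} [Group D] [Group E] [Group G] (S : GroupExtension D E G)

theorem rightHom_eq_one_iff (x : E) : S.rightHom x = 1 ↔ x ∈ S.inl.range := by
  rw [S.range_inl_eq_ker_rightHom, MonoidHom.mem_ker]

/-- A cocycle that vanishes as soon as one entry is in `D` is unchanged when one entry is
multiplied by an element of `D`. -/
theorem cocycle_update_mul {m : ℕ} {f : Cochain E m} (hδ : δ E m f = 0)
    (hf : ∀ x : Fin m → E, (∃ i, x i ∈ S.inl.range) → f x = 0) (k : ℕ) :
    ∀ (hk : k < m) (x : Fin m → E) (d : E), d ∈ S.inl.range →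
      f (Function.update x ⟨k, hk⟩ (d * x ⟨k, hk⟩)) = f x := by
  have key : ∀ (p : Fin (m + 1)) (x : Fin m → E) (d : E) (j : Fin (m + 1)), d ∈ S.inl.range →
      j ≠ p → (j : ℕ) + 1 ≠ p → f (Fin.contractNth j (· * ·) (p.insertNth d x)) = 0 := by
    intro p x d j hd hjp hjp'
    obtain ⟨k, hk⟩ := exists_contractNth_eq (p.insertNth d x : Fin (m + 1) → E) hjp hjp'
    exact hf _ ⟨k, by rwa [hk, Fin.insertNth_apply_same]⟩
  have hins : ∀ (p : Fin (m + 1)) (x : Fin m → E) (d : E) (i : Fin (m + 1)),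
      (p.insertNth d x : Fin (m + 1) → E) i =
        if h : (i : ℕ) < p then x ⟨i, by omega⟩
        else if h' : (i : ℕ) = p then d else x ⟨i - 1, by omega⟩ := by
    intro p x d i
    induction i using Fin.succAboveCases p with
    | x =>
      simp
    | p i =>
      rw [Fin.insertNth_apply_succAbove]
      rcases lt_or_ge i.castSucc p with h | h
      · rw [Fin.succAbove_of_castSucc_lt _ _ h]
        have h1 : (i : ℕ) < p := h
        simp [h1]
      · rw [Fin.succAbove_of_le_castSucc _ _ h]
        have h1 : (p : ℕ) ≤ i := h
        have h2 : ¬ (i : ℕ) + 1 < p := by omega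
        have h3 : (i : ℕ) + 1 ≠ p := by omega
        simp [h2, h3]
  -- merging the inserted entry with its right neighbour
  have hright : ∀ (k : ℕ) (hk : k < m) (x : Fin m → E) (d : E),
      Fin.contractNth ⟨k, by omega⟩ (· * ·)
        ((⟨k, by omega⟩ : Fin (m + 1)).insertNth d x : Fin (m + 1) → E) =
      Function.update x ⟨k, hk⟩ (d * x ⟨k, hk⟩) := by
    intro k hk x d
    funext i
    obtain ⟨i, hi⟩ := i
    simp only [Fin.contractNth, hins, Function.update_apply, Fin.mk.injEq, Fin.val_castSucc,
      Fin.val_succ]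
    rcases lt_trichotomy i k with h | h | h
    · simp [h, h.ne]
    · subst h
      simp
    · simp [h.ne', not_lt.2 h.le, show ¬ i + 1 < k by omega, show i + 1 ≠ k by omega]
  -- merging the inserted entry with its left neighbour
  have hleft : ∀ (k : ℕ) (hk : k < m) (x : Fin m → E) (d : E),
      Fin.contractNth ⟨k, by omega⟩ (· * ·)
        ((⟨k + 1, by omega⟩ : Fin (m + 1)).insertNth d x : Fin (m + 1) → E) =
      Function.update x ⟨k, hk⟩ (x ⟨k, hk⟩ * d) := by
    intro k hk x d
    funext i
    obtain ⟨i, hi⟩ := i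
    simp only [Fin.contractNth, hins, Function.update_apply, Fin.mk.injEq, Fin.val_castSucc,
      Fin.val_succ]
    rcases lt_trichotomy i k with h | h | h
    · simp [h, h.ne, show i < k + 1 by omega]
    · subst h
      simp
    · simp [h.ne', not_lt.2 h.le]
  induction k with
  | zero =>
    intro hk x d hd
    -- With `d` put in front, every face that keeps `d` as an entry vanishes; deleting it and
    -- merging it with `x 0` remain.
    have h := congrFun hδ ((0 : Fin (m + 1)).insertNth d x)
    change f _ + ∑ j, _ = 0 at h
    rw [Finset.sum_eq_single (0 : Fin (m + 1))] at h
    · have h0 := hright 0 hk x d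
      rw [show (⟨0, by omega⟩ : Fin (m + 1)) = 0 from rfl] at h0
      rw [h0, show (fun i : Fin m => ((0 : Fin (m + 1)).insertNth d x : Fin (m + 1) → E) i.succ)
        = x by funext i; simp] at h
      simp only [Fin.val_zero, zero_add, pow_one, neg_smul, one_smul] at h
      exact (add_neg_eq_zero.1 h).symm
    · intro j _ hj
      rw [key 0 x d j hd hj (by simp), smul_zero]
    · simp
  | succ k ih =>
    intro hk x d hd
    -- Here the survivors merge `d` with its left and its right neighbour, so `d` can be moved from
    -- one slot to the other.
    have h := congrFun hδ ((⟨k + 1, by omega⟩ : Fin (m + 1)).insertNth d x)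
    change f _ + ∑ j, _ = 0 at h
    have hne : (⟨k, by omega⟩ : Fin (m + 1)) ≠ ⟨k + 1, by omega⟩ := by simp
    rw [Finset.sum_eq_add (⟨k, by omega⟩ : Fin (m + 1)) ⟨k + 1, by omega⟩ hne] at h
    · have h0 : f (fun i : Fin m =>
          ((⟨k + 1, by omega⟩ : Fin (m + 1)).insertNth d x : Fin (m + 1) → E) i.succ) = 0 := by
        refine hf _ ⟨⟨k, by omega⟩, ?_⟩
        rw [show Fin.succ (⟨k, by omega⟩ : Fin m) = ⟨k + 1, by omega⟩ from rfl,
          Fin.insertNth_apply_same]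
        exact hd
      rw [h0, hleft k (by omega), hright (k + 1) hk, zero_add, pow_succ _ (k + 1),
        mul_neg_one, neg_smul, ← sub_eq_add_neg, ← smul_sub] at h
      have h1 := sub_eq_zero.1 (((Int.isUnit_iff.2 (by
        rcases neg_one_pow_eq_or ℤ (k + 1) with h | h <;> simp [h])).smul_eq_zero).1 h)
      rw [← h1]
      obtain ⟨y, hy⟩ := hd
      -- By normality of D, right multiplication of entry `k` is left multiplication by a conjugate,
      -- the case already known.
      have h2 : x ⟨k, by omega⟩ * d =
          (x ⟨k, by omega⟩ * d * (x ⟨k, by omega⟩)⁻¹) * x ⟨k, by omega⟩ := by group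
      rw [h2]
      refine ih (by omega) x _ ⟨S.conjAct (x ⟨k, by omega⟩) y, ?_⟩
      rw [S.inl_conjAct_comm, hy]
    · rintro j - ⟨hj, hj'⟩
      rw [key _ x d j hd hj' (by simpa [Fin.ext_iff] using hj), smul_zero]
    · simp
    · simp

/-- Two lifts of one tuple of G differ entrywise by left factors in D, which are exchanged one slot
at a time. -/
theorem cocycle_eq_of_rightHom_eq {m : ℕ} {f : Cochain E m} (hδ : δ E m f = 0)
    (hf : ∀ x : Fin m → E, (∃ i, x i ∈ S.inl.range) → f x = 0) {x x' : Fin m → E}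
    (h : ∀ i, S.rightHom (x i) = S.rightHom (x' i)) : f x = f x' := by
  classical
  have key : ∀ s : Finset (Fin m), f (s.piecewise x x') = f x' := by
    intro s
    induction s using Finset.induction_on with
    | empty => simp
    | insert j s hj ih =>
      rw [Finset.piecewise_insert]
      have h1 : x j = (x j * (x' j)⁻¹) * s.piecewise x x' j := by
        rw [Finset.piecewise_eq_of_notMem _ _ _ hj]
        group
      rw [h1]
      refine (cocycle_update_mul S hδ hf j j.2 _ _ ?_).trans ih
      rw [← rightHom_eq_one_iff, map_mul, map_inv, h, mul_inv_cancel]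
  simpa using key Finset.univ

theorem pullback_injective {H : Type*} [Group H] {φ : H →* G} (hφ : Function.Surjective φ)
    (n : ℕ) : Function.Injective (pullback φ n) := by
  intro f f' h
  funext g
  choose y hy using fun i => hφ (g i)
  have h1 := congrFun h y
  simpa [pullback, hy] using h1

/-- A cocycle in `F^m C^m` is the pullback of a cocycle of the quotient. -/
theorem exists_pullback_rightHom_eq {m : ℕ} {f : Cochain E m} (hδ : δ E m f = 0)
    (hf : f ∈ F S m m) : ∃ θ ∈ Z G m, pullback S.rightHom m θ = f := by
  have hf' : ∀ x : Fin m → E, (∃ i, x i ∈ S.inl.range) → f x = 0 := by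
    rintro x ⟨i, hi⟩
    exact hf.2 {i} (by simp) x (by simpa using hi)
  -- Any set-theoretic section will do, since `f` only sees images in G.
  choose σ hσ using S.rightHom_surjective
  have hθ : pullback S.rightHom m (fun g => f fun i => σ (g i)) = f := by
    funext x
    exact cocycle_eq_of_rightHom_eq S hδ hf' fun i => hσ _
  refine ⟨fun g => f fun i => σ (g i), ⟨?_, ?_⟩, hθ⟩
  · rintro g ⟨i, hi⟩
    exact hf' _ ⟨i, by rw [← rightHom_eq_one_iff, hσ, hi]⟩
  · refine pullback_injective S.rightHom_surjective (m + 1) ?_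
    rw [← δ_pullback, hθ, hδ, map_zero]

end Pullback

/-! ### Homogeneous pullback along a map of sets. -/

section Quotients

variable {E D : Type*} [Group E] [Group D]

/-- The successive quotients of the images under `ρ` of the partial products of `x`. -/
def quotients (ρ : E → D) {n : ℕ} (x : Fin n → E) (k : Fin n) : D :=
  (ρ (Fin.partialProd x k.castSucc))⁻¹ * ρ (Fin.partialProd x k.succ)

theorem partialProd_quotients {ρ : E → D} (hρ : ρ 1 = 1) {n : ℕ} (x : Fin n → E)
    (k : Fin (n + 1)) : Fin.partialProd (quotients ρ x) k = ρ (Fin.partialProd x k) := by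
  have h := congrFun (Fin.partialProd_left_inv fun i => ρ (Fin.partialProd x i)) k
  simp only [hρ, Fin.partialProd_zero, one_smul] at h
  exact h

/-- Merging two entries omits one partial product, whatever `ρ` is. -/
theorem quotients_contractNth {ρ : E → D} (hρ : ρ 1 = 1) {n : ℕ} (x : Fin (n + 1) → E)
    (j : Fin (n + 1)) : quotients ρ (Fin.contractNth j (· * ·) x) =
      Fin.contractNth j (· * ·) (quotients ρ x) := by
  funext k
  rw [← Fin.inv_partialProd_mul_eq_contractNth, partialProd_quotients hρ,
    partialProd_quotients hρ, quotients, Fin.partialProd_contractNth, Function.comp_apply,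
    Function.comp_apply, Fin.succ_succAbove_succ]

/-- Dropping the first entry restarts the partial products at 1, so this is the one face that sees
the failure of `ρ` to be equivariant. -/
theorem tail_quotients (ρ : E → D) {n : ℕ} (x : Fin (n + 1) → E) :
    Fin.tail (quotients ρ x) = quotients (fun y => ρ (x 0 * y)) (Fin.tail x) := by
  funext k
  simp only [Fin.tail, quotients]
  rw [← Fin.succ_castSucc, Fin.partialProd_succ', Fin.partialProd_succ']

theorem quotients_apply_eq_one {ρ : E → D} {n : ℕ} {x : Fin n → E} {k : Fin n} (h : x k = 1) :
    quotients ρ x k = 1 := by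
  rw [quotients, Fin.partialProd_succ, h, mul_one, inv_mul_cancel]

end Quotients

theorem tail_contractNth_zero {E : Type*} [Group E] {n : ℕ} (x : Fin (n + 2) → E) :
    Fin.tail (Fin.contractNth 0 (· * ·) x) = Fin.tail (Fin.tail x) := by
  funext k
  simp [Fin.tail, Fin.contractNth]

theorem tail_contractNth_succ {E : Type*} [Group E] {n : ℕ} (x : Fin (n + 2) → E)
    (j : Fin (n + 1)) : Fin.tail (Fin.contractNth j.succ (· * ·) x) =
      Fin.contractNth j (· * ·) (Fin.tail x) := by
  funext k
  simp [Fin.tail, Fin.contractNth]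

/-! ### Lifting an invariant class through the pages. -/

section Transgression

variable {D E G : Type*} [Group D] [Group E] [Group G] (S : GroupExtension D E G)

/-- The coboundary of the cochain `ω (quotients ρ x) + η (λ x₀) (tail (quotients ρ x))`. -/
theorem δ_add_apply {m : ℕ} {ω : Cochain D (m + 1)} (hω : δ D (m + 1) ω = 0)
    (η : G → Cochain D m) {ρ : E → D} (hρ : ρ 1 = 1) (x : Fin (m + 2) → E) :
    δ E (m + 1) (fun x => ω (quotients ρ x) + η (S.rightHom (x 0)) (Fin.tail (quotients ρ x))) x =
      ω (quotients ρ (Fin.tail x)) - ω (Fin.tail (quotients ρ x))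
        - δ D m (η (S.rightHom (x 0))) (Fin.tail (quotients ρ x))
        + η (S.rightHom (x 1)) (Fin.tail (quotients ρ (Fin.tail x)))
        - η (S.rightHom (x 0 * x 1)) (Fin.tail (Fin.tail (quotients ρ x)))
        + η (S.rightHom (x 0)) (Fin.tail (Fin.tail (quotients ρ x))) := by
  have h := congrFun hω (quotients ρ x)
  rw [δ_apply] at h
  rw [δ_apply, δ_apply]
  simp only [smul_add, Finset.sum_add_distrib, quotients_contractNth hρ]
  -- The cocycle condition replaces the alternating sum in `ω` by minus its front face.
  rw [← neg_eq_of_add_eq_zero_right h]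
  rw [Fin.sum_univ_succ (n := m + 1)]
  simp only [tail_contractNth_succ, tail_contractNth_zero]
  have h0 : Fin.contractNth (0 : Fin (m + 2)) (· * ·) x 0 = x 0 * x 1 := by
    simp [Fin.contractNth]
  have hs : ∀ j : Fin (m + 1), Fin.contractNth j.succ (· * ·) x 0 = x 0 := by
    intro j
    simp [Fin.contractNth]
  simp only [h0, hs, Fin.val_succ, Fin.val_zero, pow_succ _ (_ + 1), mul_neg_one, neg_smul,
    Finset.sum_neg_distrib, zero_add, pow_one, one_smul]
  rw [show Fin.tail x 0 = x 1 from rfl]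
  abel

/-- A cocycle of `D` with an invariant class is the restriction of a cochain in `Z_2^{0,n}`. -/
theorem exists_mem_Zr_two {n : ℕ} (ω : Z D n) (hω : IsInvariant S (H.mk ω)) :
    ∃ c ∈ Zr S 2 0 n, pullback S.inl n c = ω := by
  classical
  cases n with
  | zero =>
    refine ⟨fun _ => ω.1 Fin.elim0, ⟨⟨?_, ?_⟩, ?_⟩, ?_⟩
    · rintro x ⟨i, -⟩
      exact i.elim0
    · intro s hs
      have : s.card = 0 := by simp [Finset.eq_empty_of_isEmpty s]
      simp [this] at hs
    · have h : δ E 0 (fun _ => ω.1 Fin.elim0) = 0 := by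
        funext x
        simp [δ]
      change δ E 0 _ ∈ F S (0 + 2) (0 + 1)
      rw [h]
      exact zero_mem _
    · funext x
      exact congrArg ω.1 (Subsingleton.elim _ _)
  | succ m =>
    have hη : ∀ y : E, ∃ η ∈ C D m,
        δ D m η = pullback (S.conjAct y).toMonoidHom (m + 1) ω.1 - ω.1 := by
      intro y
      have h := QuotientAddGroup.eq.1 (hω y).symm
      obtain ⟨η, hη, h⟩ := AddSubgroup.mem_addSubgroupOf.1 h
      exact ⟨η, hη, by rw [h, sub_eq_neg_add]; rfl⟩
    choose η₀ hη₀ hδη₀ using hη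
    choose σ₀ hσ₀ using S.rightHom_surjective
    -- Normalising `σ` at 1 makes `ρ` the identity on D.
    let σ : G → E := Function.update σ₀ 1 1
    have hσ1 : σ 1 = 1 := Function.update_self ..
    have hσ : ∀ g, S.rightHom (σ g) = g := by
      intro g
      by_cases hg : g = 1
      · rw [hg, hσ1, map_one]
      · rw [show σ g = σ₀ g from Function.update_of_ne hg _ _, hσ₀]
    -- The value 0 at 1 keeps `c` normalised and makes it restrict to `ω`.
    let η : G → Cochain D m := Function.update (fun g => η₀ (σ g)⁻¹) 1 0
    have hη1 : η 1 = 0 := Function.update_self ..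
    have hη : ∀ g, g ≠ 1 → η g = η₀ (σ g)⁻¹ := fun g hg => Function.update_of_ne hg _ _
    have hηC : ∀ g, η g ∈ C D m := by
      intro g
      by_cases hg : g = 1
      · rw [hg, hη1]
        exact zero_mem _
      · rw [hη g hg]
        exact hη₀ _
    have hρ : ∀ y : E, ∃ d : D, S.inl d = y * (σ (S.rightHom y))⁻¹ := fun y =>
      (rightHom_eq_one_iff S _).1 (by rw [map_mul, map_inv, hσ, mul_inv_cancel])
    choose ρ hρ using hρ
    have hρ1 : ρ 1 = 1 := S.inl_injective (by simp [hρ, hσ1])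
    have hρmul : ∀ (d : D) (y : E), ρ (S.inl d * y) = d * ρ y := by
      intro d y
      apply S.inl_injective
      rw [map_mul, hρ, hρ, map_mul, (rightHom_eq_one_iff S _).2 ⟨d, rfl⟩, one_mul, mul_assoc]
    have hinl : ∀ {k : ℕ} (x : Fin k → E) (i : Fin k), S.inl (quotients ρ x i) =
        σ (S.rightHom (Fin.partialProd x i.castSucc)) * x i *
          (σ (S.rightHom (Fin.partialProd x i.succ)))⁻¹ := by
      intro k x i
      rw [quotients, map_mul, map_inv, hρ, hρ, Fin.partialProd_succ]
      group
    have hprod : ∀ {k : ℕ} (x : Fin k → E) (_ : ∀ i, x i ∈ S.inl.range) (i : Fin (k + 1)),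
        S.rightHom (Fin.partialProd x i) = 1 := by
      intro k x hx i
      induction i using Fin.induction with
      | zero => simp
      | succ i ih => rw [Fin.partialProd_succ, map_mul, ih, (rightHom_eq_one_iff S _).2 (hx i),
          one_mul]
    have hquot : ∀ {k : ℕ} (x : Fin k → E) (_ : ∀ i, x i ∈ S.inl.range) (i : Fin k),
        S.inl (quotients ρ x i) = x i := by
      intro k x hx i
      rw [hinl, hprod x hx, hprod x hx, hσ1, one_mul, inv_one, mul_one]
    let c : Cochain E (m + 1) := fun x =>
      ω.1 (quotients ρ x) + η (S.rightHom (x 0)) (Fin.tail (quotients ρ x))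
    have hcC : c ∈ C E (m + 1) := by
      rintro x ⟨i, hi⟩
      have h1 : quotients ρ x i = 1 := quotients_apply_eq_one hi
      change ω.1 _ + η _ _ = 0
      rw [ω.2.1 _ ⟨i, h1⟩, zero_add]
      cases i using Fin.cases with
      | zero => rw [hi, map_one, hη1]; rfl
      | succ i => exact hηC _ _ ⟨i, h1⟩
    refine ⟨c, ⟨⟨hcC, ?_⟩, ⟨?_, ?_⟩⟩, ?_⟩
    · intro s hs
      have := s.card_le_univ
      rw [Fintype.card_fin] at this
      push_cast at hs
      omega
    · rintro x ⟨i, hi⟩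
      exact δ_mem_C hcC x ⟨i, hi⟩
    · intro s hs x hx
      change δ E (m + 1) c x = 0
      rw [δ_add_apply S ω.2.2 η hρ1]
      -- At least `m + 1` of the `m + 2` entries are in D: either `x 0` is, and equivariance of `ρ`
      -- cancels the terms, or all others are, and δη cancels the conjugation.
      by_cases h0 : x 0 ∈ S.inl.range
      · have h1 : S.rightHom (x 0) = 1 := (rightHom_eq_one_iff S _).2 h0
        have ht : Fin.tail (quotients ρ x) = quotients ρ (Fin.tail x) := by
          obtain ⟨d, hd⟩ := h0
          rw [tail_quotients]
          funext k
          simp only [quotients, ← hd, hρmul]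
          group
        rw [map_mul, h1, one_mul, hη1, ht, map_zero]
        simp
      · have hs' : s = Finset.univ.erase 0 := by
          refine Finset.eq_of_subset_of_card_le (fun i hi => ?_) ?_
          · refine Finset.mem_erase.2 ⟨?_, Finset.mem_univ _⟩
            rintro rfl
            exact h0 (hx _ hi)
          · rw [Finset.card_erase_of_mem (Finset.mem_univ _), Finset.card_univ, Fintype.card_fin]
            push_cast at hs
            omega
        have hxt : ∀ i, Fin.tail x i ∈ S.inl.range := fun i =>
          hx i.succ (by rw [hs']; simp)
        have h1 : S.rightHom (x 1) = 1 := (rightHom_eq_one_iff S _).2 (hxt 0)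
        have hg : S.rightHom (x 0) ≠ 1 := fun h => h0 ((rightHom_eq_one_iff S _).1 h)
        have ht : quotients ρ (Fin.tail x) = fun i =>
            S.conjAct (σ (S.rightHom (x 0)))⁻¹ (Fin.tail (quotients ρ x) i) := by
          funext i
          apply S.inl_injective
          have hp : ∀ i : Fin (m + 2),
              S.rightHom (Fin.partialProd x i.succ) = S.rightHom (x 0) := by
            intro i
            rw [Fin.partialProd_succ', map_mul, hprod _ hxt, mul_one]
          rw [hquot _ hxt, S.inl_conjAct_comm, Fin.tail, Fin.tail, hinl, ← Fin.succ_castSucc,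
            hp, hp]
          group
        rw [map_mul, h1, mul_one, hη1, hη _ hg, hδη₀, ht]
        simp [pullback]
    · funext x
      have h1 : ∀ i, S.inl (x i) ∈ S.inl.range := fun i => ⟨x i, rfl⟩
      have h2 : quotients ρ (fun i => S.inl (x i)) = x :=
        funext fun i => S.inl_injective (hquot _ h1 i)
      change ω.1 (quotients ρ fun i => S.inl (x i)) + η (S.rightHom (S.inl (x 0))) _ = ω.1 x
      rw [(rightHom_eq_one_iff S _).2 (h1 0), hη1, h2]
      simp

/-- If `d_r` kills the class of a cochain in `Z_r^{0,n}`, then the cochain can be changed by one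
that vanishes on `D` so that it is in `Z_{r+1}^{0,n}`. -/
theorem exists_mem_Zr_succ {r : ℤ} {n : ℕ} {c : Cochain E n} (hc : c ∈ Zr S r 0 n)
    (h : dr S r 0 n (QuotientAddGroup.mk ⟨c, hc⟩) = 0) :
    ∃ c' ∈ Zr S (r + 1) 0 n, pullback S.inl n c' = pullback S.inl n c := by
  obtain ⟨b, ⟨⟨y, hy, hyb⟩, -⟩, z, hz, hbz⟩ := AddSubgroup.mem_sup.1
    (AddSubgroup.mem_addSubgroupOf.1 ((QuotientAddGroup.eq_zero_iff _).1 h))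
  -- The index is p - r + 1 at p = r.
  have hy1 : y ∈ F S 1 n := by simpa using hy
  refine ⟨c - y, ⟨(F S 0 n).sub_mem hc.1 (F_mono S zero_le_one n hy1), ?_⟩, ?_⟩
  · change δ E n (c - y) ∈ F S (0 + (r + 1)) (n + 1)
    have hz' : δ E n (c - y) = z := by
      rw [map_sub, hyb, sub_eq_iff_eq_add']
      exact hbz.symm
    rw [hz', ← add_assoc]
    exact hz.1
  · rw [map_sub, pullback_inl_eq_zero S le_rfl hy1, sub_zero]

/-- If the first `k` obstructions of `ω` vanish, then `ω` is the restriction of a cochain in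
`Z_{k+2}^{0,n}`. -/
theorem exists_mem_Zr_of_obstructionVanishes {n : ℕ} (ω : Z D n) (hω : IsInvariant S (H.mk ω))
    (k : ℕ) (h : ∀ r : ℤ, 2 ≤ r → r ≤ k + 1 → ObstructionVanishes S (H.mk ω) r) :
    ∃ c ∈ Zr S (k + 2) 0 n, pullback S.inl n c = ω := by
  induction k with
  | zero => simpa using exists_mem_Zr_two S ω hω
  | succ k ih =>
    push_cast at h ⊢
    obtain ⟨c, hc, hcω⟩ := ih fun r h2 hr => h r h2 (by omega)
    have hd := h (k + 2) (by omega) (by omega) (by omega) (QuotientAddGroup.mk ⟨c, hc⟩)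
      (congrArg QuotientAddGroup.mk (Subtype.ext hcω))
    obtain ⟨c', hc', h'⟩ := exists_mem_Zr_succ S hc hd
    refine ⟨c', ?_, h'.trans hcω⟩
    rwa [show (k : ℤ) + 1 + 2 = k + 2 + 1 by ring]

end Transgression

end LHS

/-- The obstructions are `d_r^{0,n} ω` for `r = 2, …, n + 1`; the first `n - 1` of them are those for
`r = 2, …, n`. They are defined for `ω` with an invariant class, as `E_2^{0,n} = H^n(D; U(1))^G`. -/
theorem mainTheorem8 {D E G : Type*} [Group D] [Group E] [Group G] (S : GroupExtension D E G)
    (n : ℕ) (ω : LHS.Z D n) (hω : LHS.IsInvariant S (LHS.H.mk ω)) :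
    ((∀ r : ℤ, 2 ≤ r → r ≤ n + 1 → LHS.ObstructionVanishes S (LHS.H.mk ω) r) →
      ∃ ω' ∈ LHS.Z E n, LHS.pullback S.inl n ω' = ω) ∧
    ((∀ r : ℤ, 2 ≤ r → r ≤ n → LHS.ObstructionVanishes S (LHS.H.mk ω) r) →
      ∃ ω' ∈ LHS.C E n, ∃ θ ∈ LHS.Z G (n + 1),
        LHS.pullback S.inl n ω' = ω ∧ LHS.δ E n ω' = LHS.pullback S.rightHom (n + 1) θ) := by
  refine ⟨fun h => ?_, fun h => ?_⟩
  · obtain ⟨c, hc, hcω⟩ := LHS.exists_mem_Zr_of_obstructionVanishes S ω hω n h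
    refine ⟨c, ⟨hc.1.1, ?_⟩, hcω⟩
    funext x
    -- In F^(n+2) C^(n+1) the required number of entries in D is 0.
    exact hc.2.2 ∅ (by simp) x (by simp)
  · obtain ⟨c, hc, hcω⟩ : ∃ c ∈ LHS.Zr S (n + 1) 0 n, LHS.pullback S.inl n c = ω := by
      cases n with
      -- There is no page 1 to start from: the lift in Z_2 is weakened to Z_1.
      | zero =>
        obtain ⟨c, hc, hcω⟩ := LHS.exists_mem_Zr_two S ω hω
        exact ⟨c, ⟨hc.1, LHS.F_mono S (by simp) _ hc.2⟩, hcω⟩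
      | succ n =>
        have := LHS.exists_mem_Zr_of_obstructionVanishes S ω hω n (by simpa using h)
        push_cast
        rwa [show (n : ℤ) + 1 + 1 = n + 2 by ring]
    obtain ⟨θ, hθ, hθc⟩ := LHS.exists_pullback_rightHom_eq S (LHS.δ_δ E n c)
      (by simpa using hc.2)
    exact ⟨c, hc.1.1, θ, hθ, hcω, hθc.symm⟩
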